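/- Setting. A substrate is a finite directed graph $G_S=(V_S,E_S)$ with capacities $d_S\ge 0$ and costs $c_S\ge 0$ on nodes and edges and latencies $l_S\ge 0$ on edges. A request is a finite directed graph $G_r=(V_r,E_r)$ with demands $d_r\ge 0$ on nodes and edges, a latency bound $T_r\ge 0$, and a set of forbidden substrate nodes (edges) for each request node (edge). A valid mapping $m=(m^V,m^E)$ assigns to each $i\in V_r$ a non-forbidden node $m^V(i)\in V_S$ with $d_S(m^V(i))\ge d_r(i)$, and to each $(i,j)\in E_r$ a simple path $m^E(i,j)$ in $G_S$ from $m^V(i)$ to $m^V(j)$ (possibly trivial) all of whose edges $e$ are non-forbidden and satisfy $d_S(e)\ge d_r(i,j)$. It is valid under the strict latency bound if $\sum_{e\in m^E(i,j)} l_S(e)\le T_r$ for all $(i,j)\in E_r$, and valid under the $(1+\varepsilon)$-approximate latency bound if these sums are at most $(1+\varepsilon)T_r$. Its cost is $c(m)=\sum_{x\in V_S\cup E_S} c_S(x)A(m,x)$, where $A(m,v)=\sum_{i:\,m^V(i)=v}d_r(i)$ for nodes and $A(m,e)=\sum_{(i,j):\,e\in m^E(i,j)}d_r(i,j)$ for edges.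 Algorithm. APRSP_Goel computes, for each request edge, in the graph of the substrate edges that may carry it, paths between all pairs of nodes, by running the following procedure of Goel et al. from each source: for the resolutions $\tau=1,2,4,\dots$ replace the latencies by the integers $\lfloor \tau\, l_S(e)/T_r\rfloor$ (if $T_r=0$, edges of positive latency are excluded); compute by dynamic programming over the integer budgets $0,\dots,\tau$ (with Dijkstra's algorithm along edges of integer latency $0$) a cheapest path of integer latency at most $\tau$ to each target; stop as soon as all computed paths have latency at most $(1+\varepsilon)T_r$. The modified DynVMP takes a rooted tree decomposition of $G_r$ and, from the leaves to the root, computes for every valid mapping of a bag a cheapest extension to the request nodes occurring in the subtree, using the paths of APRSP_Goel and their costs for the request edges; it returns the cheapest mapping found at the root together with the corresponding paths. Lemma. Let $\varepsilon>0$, and let a rooted tree decomposition of $G_r$ be given. If there is a mapping that is valid under the strict latency bound, then the modified DynVMP terminates and returns a mapping $m$ that is valid under the $(1+\varepsilon)$-approximate latency bound and satisfies $c(m)\le c(m')$ for every mapping $m'$ valid under the strict latency bound. -/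

import Mathlib

open scoped NNReal ENNReal

namespace VNEP

/-! ## Paths in finite directed graphs

A directed graph on `V` is given by its set `E : Finset (V × V)` of edges, and a path by the list
of the nodes that it visits. -/

section Paths

variable {V : Type*}

/-- The edges traversed by a path. -/
def pathEdges (p : List V) : List (V × V) := p.zip p.tail

/-- The total weight of the edges of a path (its cost or its latency). -/
def pathWeight {M : Type*} [AddMonoid M] (w : V × V → M) (p : List V) : M :=
  ((pathEdges p).map w).sum

/-- `p` is a simple path from `s` to `t` in the graph with edge set `E`. For `s = t` this is the
trivial path `[s]`. -/
def IsSimplePath (E : Finset (V × V)) (s t : V) (p : List V) : Prop :=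
  p.head? = some s ∧ p.getLast? = some t ∧ p.IsChain (fun u v => (u, v) ∈ E) ∧ p.Nodup

end Paths

/-! ## Substrate, requests and mappings -/

/-- A substrate network: a directed graph with capacities, costs and edge latencies. -/
structure Substrate (V : Type*) where
  edges : Finset (V × V)
  nodeCap : V → ℝ≥0
  edgeCap : V × V → ℝ≥0
  nodeCost : V → ℝ≥0
  edgeCost : V × V → ℝ≥0
  latency : V × V → ℝ≥0

/-- A request: a directed graph on `W` with demands, a latency bound, and, for each of its nodes
and edges, a set of forbidden substrate nodes, respectively edges. -/
structure Request (W V : Type*) where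
  edges : Finset (W × W)
  nodeDemand : W → ℝ≥0
  edgeDemand : W × W → ℝ≥0
  latencyBound : ℝ≥0
  forbiddenNodes : W → Finset V
  forbiddenEdges : W × W → Finset (V × V)

/-- A mapping: a substrate node for each request node, a substrate path for each request edge. -/
structure Mapping {W V : Type*} (R : Request W V) where
  node : W → V
  edge : R.edges → List V

section Model

variable {W V : Type*} [DecidableEq V]

/-- The substrate node `u` has enough capacity for the request node `i` and is not forbidden. -/
def NodeOK (S : Substrate V) (R : Request W V) (i : W) (u : V) : Prop :=
  R.nodeDemand i ≤ S.nodeCap u ∧ u ∉ R.forbiddenNodes i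

/-- The substrate edges that may carry the request edge `e`: those of enough capacity that are not
forbidden. -/
noncomputable def usableEdges (S : Substrate V) (R : Request W V) (e : W × W) :
    Finset (V × V) :=
  S.edges.filter fun x => R.edgeDemand e ≤ S.edgeCap x ∧ x ∉ R.forbiddenEdges e

/-- Valid mappings, regardless of latencies. -/
def Mapping.Valid (S : Substrate V) {R : Request W V} (m : Mapping R) : Prop :=
  (∀ i, NodeOK S R i (m.node i)) ∧
  ∀ e : R.edges,
    IsSimplePath (usableEdges S R e.1) (m.node e.1.1) (m.node e.1.2) (m.edge e)

/-- Validity under the strict latency constraint. -/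
def Mapping.StrictlyValid (S : Substrate V) {R : Request W V} (m : Mapping R) : Prop :=
  m.Valid S ∧ ∀ e, pathWeight S.latency (m.edge e) ≤ R.latencyBound

/-- Validity under the `(1 + ε)`-approximate latency constraint. -/
def Mapping.ApproxValid (S : Substrate V) (ε : ℝ≥0) {R : Request W V} (m : Mapping R) : Prop :=
  m.Valid S ∧ ∀ e, pathWeight S.latency (m.edge e) ≤ (1 + ε) * R.latencyBound

/-- The allocation `A(m, v)` on a substrate node. -/
def Mapping.nodeAlloc [Fintype W] {R : Request W V} (m : Mapping R) (v : V) : ℝ≥0 :=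
  ∑ i with m.node i = v, R.nodeDemand i

/-- The allocation `A(m, x)` on a substrate edge. -/
def Mapping.edgeAlloc {R : Request W V} (m : Mapping R) (x : V × V) : ℝ≥0 :=
  ∑ e : R.edges with x ∈ pathEdges (m.edge e), R.edgeDemand e.1

/-- The cost `c(m) = ∑ c(x) * A(m, x)`, over all substrate nodes and edges `x`. -/
def Mapping.cost [Fintype W] [Fintype V] (S : Substrate V) {R : Request W V} (m : Mapping R) :
    ℝ≥0 :=
  ∑ v, S.nodeCost v * m.nodeAlloc v + ∑ x ∈ S.edges, S.edgeCost x * m.edgeAlloc x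

end Model

/-! ## Goel et al.'s algorithm for restricted shortest paths

For a source `s`, latencies are scaled to integers with a resolution `τ`, and a dynamic program
computes, for every integer budget `d ≤ τ` and every node `v`, a cheapest path from `s` to `v` of
scaled latency at most `d`. The resolution is doubled until all the paths found for the budget `τ`
meet the `(1 + ε)`-approximate latency bound. -/

section Goel

variable {V : Type*} [FinEnum V]

/-- A table holds, for each node, the path from the source found so far, if any. -/
abbrev PathTable (V : Type*) := V → Option (List V)

/-- The cost of a table entry (`⊤` if there is no path). -/
def entryCost (c : V × V → ℝ≥0) (o : Option (List V)) : ℝ≥0∞ :=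
  o.elim ⊤ fun p => ((pathWeight c p : ℝ≥0) : ℝ≥0∞)

/-- Keep `old` unless `new` is strictly cheaper. -/
noncomputable def better (c : V × V → ℝ≥0) (old new : Option (List V)) : Option (List V) :=
  if entryCost c new < entryCost c old then new else old

/-- Extend a path by one more node. -/
def extend (o : Option (List V)) (v : V) : Option (List V) :=
  o.map fun p => p ++ [v]

/-- One step of Dijkstra's algorithm along the edges of `Z`. The state consists of the current
labels and the set of settled nodes; a cheapest unsettled node is settled and its outgoing edges
are relaxed. -/
noncomputable def dijkstraStep (Z : Finset (V × V)) (c : V × V → ℝ≥0)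
    (st : PathTable V × Finset V) : PathTable V × Finset V :=
  match ((FinEnum.toList V).filter fun u => u ∉ st.2 ∧ (st.1 u).isSome).argmin
      (fun u => entryCost c (st.1 u)) with
  | none => st
  | some u =>
      (fun w => if w ∉ insert u st.2 ∧ (u, w) ∈ Z then better c (st.1 w) (extend (st.1 u) w)
        else st.1 w,
       insert u st.2)

/-- Dijkstra's algorithm along the edges of `Z`, started from given labels. -/
noncomputable def dijkstra (Z : Finset (V × V)) (c : V × V → ℝ≥0) (L : PathTable V) :
    PathTable V :=
  ((dijkstraStep Z c)^[FinEnum.card V] (L, ∅)).1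

/-- The dynamic program, for the integer latencies `lam` and the source `s`. The table for the
budget `d` starts from the table for the budget `d - 1`, extends the paths of smaller budgets by
edges of positive latency, and then follows edges of latency zero by Dijkstra's algorithm. -/
noncomputable def layer (E : Finset (V × V)) (c : V × V → ℝ≥0) (lam : V × V → ℕ) (s : V)
    (d : ℕ) : PathTable V :=
  dijkstra (E.filter fun x => lam x = 0) c fun v =>
    (FinEnum.toList V).foldl
      (fun best u =>
        if h : (u, v) ∈ E ∧ 0 < lam (u, v) ∧ lam (u, v) ≤ d then
          better c best (extend (layer E c lam s (d - lam (u, v)) u) v)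
        else best)
      (if _h : 0 < d then layer E c lam s (d - 1) v else if v = s then some [s] else none)
termination_by d
decreasing_by all_goals omega

/-- The integer latency at resolution `τ`: the bound `T` corresponds to `τ`, and latencies are
rounded down. If `T = 0`, edges of positive latency are given a value above the budget. -/
noncomputable def scaledLatency (T : ℝ≥0) (l : V × V → ℝ≥0) (τ : ℕ) (x : V × V) : ℕ :=
  if T = 0 then (if l x = 0 then 0 else τ + 1) else ⌊l x * τ / T⌋₊

/-- The algorithm for a single source: try the resolutions `1, 2, 4, …` and return the first table
all of whose paths have latency at most `(1 + ε) * T`. (The value is undefined if the search does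
not terminate.) -/
noncomputable def goel (E : Finset (V × V)) (c l : V × V → ℝ≥0) (T ε : ℝ≥0) (s : V) :
    Part (PathTable V) :=
  Nat.rfindOpt fun k =>
    let P := layer E c (scaledLatency T l (2 ^ k)) s (2 ^ k)
    if ∀ t, (P t).all fun p => pathWeight l p ≤ (1 + ε) * T then some P else none

/-- Run a finite family of computations; the result is defined if all of them terminate. -/
def runAll {ι α : Type*} (f : ι → Part α) : Part (ι → α) :=
  ⟨∀ i, (f i).Dom, fun h i => (f i).get (h i)⟩

/-- All-pairs restricted shortest paths: one call for each source node. -/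
noncomputable def aprspGoel (E : Finset (V × V)) (c l : V × V → ℝ≥0) (T ε : ℝ≥0) :
    Part (V → V → Option (List V)) :=
  runAll fun s => goel E c l T ε s

end Goel

/-! ## Rooted tree decompositions -/

/-- A rooted tree whose nodes carry bags. -/
inductive BagTree (W : Type*) where
  | node (bag : Finset W) (k : ℕ) (child : Fin k → BagTree W) : BagTree W

namespace BagTree

variable {W : Type*}

/-- The bag of the root. -/
def rootBag : BagTree W → Finset W
  | node B _ _ => B

/-- The set of all bags of the tree. -/
def bags : BagTree W → Set (Finset W)
  | node B _ child => insert B (⋃ j, (child j).bags)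

/-- `i` occurs in some bag of the tree. -/
def Occurs (t : BagTree W) (i : W) : Prop := ∃ B ∈ t.bags, i ∈ B

/-- For every `i`, the tree nodes whose bags contain `i` are connected in the tree: at each tree
node, if `i` occurs in the bag and below a child, then it is in the bag of that child, and if `i`
occurs below two children, then it is in the bag. -/
def Connected : BagTree W → Prop
  | node B _ child =>
      (∀ j, ∀ i ∈ B, (child j).Occurs i → i ∈ (child j).rootBag) ∧
      (∀ j j', j ≠ j' → ∀ i, (child j).Occurs i → (child j').Occurs i → i ∈ B) ∧
      ∀ j, (child j).Connected

/-- The tree is a tree decomposition of the graph on `W` with edge set `E`. -/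
def IsTreeDecomposition (t : BagTree W) (E : Finset (W × W)) : Prop :=
  (∀ i, t.Occurs i) ∧ (∀ e ∈ E, ∃ B ∈ t.bags, e.1 ∈ B ∧ e.2 ∈ B) ∧ t.Connected

end BagTree

/-! ## The dynamic program DynVMP

`P e u w` is the precomputed path for the request edge `e` if its end points are mapped to `u` and
`w` (`none` if there is none). Partial node mappings are functions `W → Option V`. -/

section DynVMP

variable {W V : Type*} [FinEnum W] [FinEnum V]

/-- The cost of a partial node mapping: the costs of the mapped nodes, and of the precomputed paths
for the request edges whose end points are both mapped. -/
noncomputable def partialCost (S : Substrate V) (R : Request W V)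
    (P : R.edges → V → V → Option (List V)) (f : W → Option V) : ℝ≥0 :=
  ∑ i, (match f i with
    | some u => R.nodeDemand i * S.nodeCost u
    | none => 0) +
  ∑ e : R.edges, (match f e.1.1, f e.1.2 with
    | some u, some w => R.edgeDemand e.1 * (P e u w).elim 0 (pathWeight S.edgeCost)
    | _, _ => 0)

/-- All mappings of the nodes of a bag. -/
def bagMappings (V : Type*) [FinEnum V] (B : Finset W) : List (W → Option V) :=
  (FinEnum.toList (B → V)).map fun g i => if h : i ∈ B then some (g ⟨i, h⟩) else none

/-- The bag mapping `f` maps the nodes of the bag to valid substrate nodes, and there is a path for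
each request edge inside the bag. -/
def BagOK (S : Substrate V) (R : Request W V) (P : R.edges → V → V → Option (List V))
    (B : Finset W) (f : W → Option V) : Prop :=
  (∀ i ∈ B, ∃ u, f i = some u ∧ NodeOK S R i u) ∧
  ∀ e : R.edges, e.1.1 ∈ B → e.1.2 ∈ B →
    ∃ u w, f e.1.1 = some u ∧ f e.1.2 = some w ∧ (P e u w).isSome

open Classical in
/-- The tables, filled from the leaves to the root. For a bag mapping `f`, the entry is a cheapest
extension of `f` to the request nodes below: for each child, the cheapest entry among the bag
mappings of the child that agree with `f` on the common nodes is selected, and the selected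
mappings are joined with `f`. There is no entry if `f` is not valid or some child has no suitable
entry. -/
noncomputable def dynTable (S : Substrate V) (R : Request W V)
    (P : R.edges → V → V → Option (List V)) :
    BagTree W → (W → Option V) → Option (W → Option V)
  | .node B k child, f =>
      let best : Fin k → Option (W → Option V) := fun j =>
        (((bagMappings V (child j).rootBag).filter
            (fun g => ∀ i ∈ B ∩ (child j).rootBag, g i = f i)).filterMap
          (fun g => dynTable S R P (child j) g)).argmin (partialCost S R P)
      if BagOK S R P B f ∧ ∀ j, (best j).isSome then
        some fun i => (f i).or ((List.finRange k).findSome? fun j => (best j).bind fun g => g i)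
      else none

/-- The node mapping selected at the root: a cheapest entry of the root table. -/
noncomputable def dynNodeMapping (S : Substrate V) (R : Request W V)
    (P : R.edges → V → V → Option (List V)) (t : BagTree W) : Option (W → Option V) :=
  ((bagMappings V t.rootBag).filterMap (fun f => dynTable S R P t f)).argmin
    (partialCost S R P)

open Classical in
/-- DynVMP for precomputed paths `P`: the selected node mapping, with the precomputed paths between
the images of the end points of the request edges. -/
noncomputable def dynVMPWith (S : Substrate V) (R : Request W V)
    (P : R.edges → V → V → Option (List V)) (t : BagTree W) : Option (Mapping R) :=
  (dynNodeMapping S R P t).bind fun f =>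
    if h : (∀ i, (f i).isSome) then
      let mV : W → V := fun i => (f i).get (h i)
      if h' : ∀ e : R.edges, (P e (mV e.1.1) (mV e.1.2)).isSome then
        some ⟨mV, fun e => (P e (mV e.1.1) (mV e.1.2)).get (h' e)⟩
      else none
    else none

/-- DynVMP with restricted shortest paths computed by `aprspGoel`, once for each request edge, in
the graph of its usable substrate edges. It returns a mapping or reports that none exists; the
value is undefined if the computation does not terminate. -/
noncomputable def dynVMPGoel (S : Substrate V) (R : Request W V) (ε : ℝ≥0) (t : BagTree W) :
    Part (Option (Mapping R)) :=
  (runAll fun e : R.edges =>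
      aprspGoel (usableEdges S R e.1) S.edgeCost S.latency R.latencyBound ε).map
    fun P => dynVMPWith S R P t

end DynVMP

end VNEP

/-! Two properties of the precomputed paths suffice (`aprspGoel_spec`): each is a simple path within
the approximate bound, and it costs no more than any simple path with the same ends within the
strict bound. Rounding latencies down keeps every strictly feasible path within the budget `τ`, so
at every resolution the dynamic program finds something at least as cheap. If `T > 0`, rounding
loses at most `T / τ` per edge, so a simple path exceeds the bound by at most `|V| * T / τ`, and the
stopping test succeeds once `|V| ≤ ε * τ`.

The delicate point is that stored paths remain simple although costs and latencies may vanish. A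
label is only replaced by a strictly cheaper one, and `PathTable.Sound` records that a node's label
is at most the cost of every initial segment of a stored path ending there. An extension that
revisits a node is therefore no cheaper than the label of that node and is rejected
(`PathTable.Sound.improve`).

With the paths fixed, the cost of a mapping depends only on the images of the request nodes. In a
tree decomposition the subtrees below a bag overlap only inside that bag, and every request edge
lies in a bag. Hence, once the bag is mapped, the children can be optimised independently; this is
inclusion-exclusion for the cost (`partialCost_restrict_union`) and induction over the tree
(`exists_dynTable_le`). The node mapping of any strictly valid mapping competes in this
minimisation, and exchanging its paths for the precomputed ones does not raise its cost. -/

namespace VNEP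

/-! ### Edges and weights of paths -/

section PathLemmas

variable {V : Type*}

theorem pathEdges_cons_cons (a b : V) (l : List V) :
    pathEdges (a :: b :: l) = (a, b) :: pathEdges (b :: l) := rfl

theorem pathEdges_append_singleton {p : List V} {u : V} (h : p.getLast? = some u) (v : V) :
    pathEdges (p ++ [v]) = pathEdges p ++ [(u, v)] := by
  induction p with
  | nil => simp at h
  | cons a l ih =>
    cases l with
    | nil => simp at h; subst h; rfl
    | cons b l =>
      rw [List.getLast?_cons_cons] at h
      have := ih h
      simp only [List.cons_append] at this ⊢
      rw [pathEdges_cons_cons, this, pathEdges_cons_cons, List.cons_append]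

theorem pathWeight_append_singleton {M : Type*} [AddMonoid M] (w : V × V → M) {p : List V} {u : V}
    (h : p.getLast? = some u) (v : V) :
    pathWeight w (p ++ [v]) = pathWeight w p + w (u, v) := by
  simp [pathWeight, pathEdges_append_singleton h]

theorem pathWeight_singleton {M : Type*} [AddMonoid M] (w : V × V → M) (s : V) :
    pathWeight w [s] = 0 := rfl

theorem pathWeight_le_of_prefix (w : V × V → ℝ≥0) {q p : List V} (h : q <+: p) :
    pathWeight w q ≤ pathWeight w p := by
  induction p using List.reverseRecOn with
  | nil => rw [List.prefix_nil.1 h]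
  | append_singleton p v ih =>
    rcases List.prefix_concat_iff.1 h with rfl | h
    · exact le_rfl
    · refine (ih h).trans ?_
      rcases hp : p.getLast? with _ | u
      · rw [List.getLast?_eq_none_iff.1 hp]; simp [pathWeight, pathEdges]
      · rw [pathWeight_append_singleton w hp]; exact le_self_add

theorem pathEdges_mem_of_isChain {E : Finset (V × V)} {p : List V}
    (h : p.IsChain fun u v => (u, v) ∈ E) {x : V × V} (hx : x ∈ pathEdges p) : x ∈ E := by
  induction p with
  | nil => simp [pathEdges] at hx
  | cons a l ih =>
    cases l with
    | nil => simp [pathEdges] at hx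
    | cons b l =>
      rw [List.isChain_cons_cons] at h
      rw [pathEdges_cons_cons, List.mem_cons] at hx
      rcases hx with rfl | hx
      · exact h.1
      · exact ih h.2 hx

theorem length_pathEdges_le (p : List V) : (pathEdges p).length ≤ p.length := by
  simp [pathEdges]

theorem pathEdges_nodup {p : List V} (h : p.Nodup) : (pathEdges p).Nodup := by
  apply List.Nodup.of_map Prod.snd
  rw [pathEdges, List.map_snd_zip (by simp)]
  exact h.sublist (List.tail_sublist p)

end PathLemmas

/-! ### Path tables under strict improvement -/

section Tables

variable {V : Type*} {c : V × V → ℝ≥0}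

theorem entryCost_some (p : List V) : entryCost c (some p) = (pathWeight c p : ℝ≥0) := rfl

theorem entryCost_none : entryCost c (none : Option (List V)) = ⊤ := rfl

theorem entryCost_better_le_left (a b : Option (List V)) :
    entryCost c (better c a b) ≤ entryCost c a := by
  unfold better
  split_ifs with h
  exacts [h.le, le_rfl]

theorem entryCost_better_le_right (a b : Option (List V)) :
    entryCost c (better c a b) ≤ entryCost c b := by
  unfold better
  split_ifs with h
  exacts [le_rfl, not_lt.1 h]

theorem better_eq_or (a b : Option (List V)) :
    better c a b = a ∨ better c a b = b ∧ entryCost c b < entryCost c a := by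
  unfold better
  split_ifs with h
  exacts [.inr ⟨rfl, h⟩, .inl rfl]

theorem le_entryCost_better {a b : Option (List V)} {x : ℝ≥0∞} (ha : x ≤ entryCost c a)
    (hb : x ≤ entryCost c b) : x ≤ entryCost c (better c a b) := by
  unfold better
  split_ifs
  exacts [hb, ha]

/-- In the last alternative the gain is strict relative to the initial value `a`, not merely to the
preceding one; `PathTable.Sound.improve` needs this form. -/
theorem foldl_better_spec {α : Type*} (l : List α) (C : α → Prop) [DecidablePred C]
    (N : α → Option (List V)) (a : Option (List V)) :
    let r := l.foldl (fun best u => if _h : C u then better c best (N u) else best) a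
    entryCost c r ≤ entryCost c a ∧
    (∀ u ∈ l, C u → entryCost c r ≤ entryCost c (N u)) ∧
    (r = a ∨ ∃ u, C u ∧ r = N u ∧ entryCost c r < entryCost c a) := by
  induction l generalizing a with
  | nil => simp
  | cons b l ih =>
    simp only [List.foldl_cons]
    by_cases hb : C b
    · simp only [hb, dite_true]
      obtain ⟨h1, h2, h3⟩ := ih (better c a (N b))
      refine ⟨h1.trans (entryCost_better_le_left _ _), fun u hu hC => ?_, ?_⟩
      · rcases List.mem_cons.1 hu with rfl | hu
        · exact h1.trans (entryCost_better_le_right _ _)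
        · exact h2 u hu hC
      · rcases h3 with h3 | ⟨u, hu, h3, h4⟩
        · rw [h3]
          rcases better_eq_or (c := c) a (N b) with h5 | ⟨h5, h6⟩
          · exact .inl h5
          · exact .inr ⟨b, hb, h5, by rwa [h5]⟩
        · exact .inr ⟨u, hu, h3, h4.trans_le (entryCost_better_le_left _ _)⟩
    · simp only [hb, dite_false]
      obtain ⟨h1, h2, h3⟩ := ih a
      refine ⟨h1, fun u hu hC => ?_, h3⟩
      rcases List.mem_cons.1 hu with rfl | hu
      · exact absurd hC hb
      · exact h2 u hu hC

/-- The tables store simple paths from `s` of integer latency at most `d`, and the label of each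
node is at most the cost of every initial segment, of a stored path, that ends in this node. -/
structure PathTable.Sound (E : Finset (V × V)) (c : V × V → ℝ≥0) (lam : V × V → ℕ) (s : V)
    (d : ℕ) (L : PathTable V) : Prop where
  isSimplePath : ∀ v p, L v = some p → IsSimplePath E s v p
  weight_le : ∀ v p, L v = some p → pathWeight lam p ≤ d
  prefix_le : ∀ v p, L v = some p → ∀ q x, q <+: p → q.getLast? = some x →
    entryCost c (L x) ≤ (pathWeight c q : ℝ≥0)

theorem PathTable.Sound.entryCost_extend {E : Finset (V × V)} {lam : V × V → ℕ} {s : V} {d : ℕ}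
    {L : PathTable V} (hL : L.Sound E c lam s d) (u v : V) :
    entryCost c (extend (L u) v) = entryCost c (L u) + (c (u, v) : ℝ≥0) := by
  rcases h : L u with _ | p
  · simp [extend, entryCost_none]
  · have := (hL.isSimplePath u p h).2.1
    simp [extend, entryCost_some, pathWeight_append_singleton c this]

/-- Improving labels strictly, by extensions of stored paths, keeps a table sound. -/
theorem PathTable.Sound.improve {E : Finset (V × V)} {lam : V × V → ℕ} {s : V} {d : ℕ}
    {L L' : PathTable V} (hL : L.Sound E c lam s d)
    (hle : ∀ w, entryCost c (L' w) ≤ entryCost c (L w))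
    (hext : ∀ w, L' w = L w ∨ ∃ u p, IsSimplePath E s u p ∧ (u, w) ∈ E ∧
      pathWeight lam p + lam (u, w) ≤ d ∧
      (∀ q x, q <+: p → q.getLast? = some x → entryCost c (L x) ≤ (pathWeight c q : ℝ≥0)) ∧
      L' w = some (p ++ [w]) ∧ entryCost c (L' w) < entryCost c (L w)) :
    L'.Sound E c lam s d := by
  refine ⟨fun v p' hv => ?_, fun v p' hv => ?_, fun v p' hv q x hq hx => ?_⟩
  · rcases hext v with h | ⟨u, p, hp, huv, -, hpre, hL', hlt⟩
    · exact hL.isSimplePath v p' (h ▸ hv)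
    · obtain rfl : p ++ [v] = p' := by rw [hL'] at hv; exact Option.some.inj hv
      -- If `p` visited `v`, the initial segment ending there would cost at least the old label of
      -- `v`, and the whole extension at least as much, contradicting the strict improvement.
      have hvp : v ∉ p := by
        intro hmem
        obtain ⟨a, b, rfl⟩ := List.append_of_mem hmem
        have h1 := hpre (a ++ [v]) v ⟨b, by simp⟩ (by simp)
        have h2 : pathWeight c (a ++ [v]) ≤ pathWeight c ((a ++ v :: b) ++ [v]) :=
          pathWeight_le_of_prefix c ⟨b ++ [v], by simp⟩
        rw [hL', entryCost_some] at hlt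
        exact absurd (hlt.trans_le (h1.trans (ENNReal.coe_le_coe.2 h2))) (lt_irrefl _)
      obtain ⟨h1, h2, h3, h4⟩ := hp
      refine ⟨?_, by simp, ?_, ?_⟩
      · rw [List.head?_append, h1]; rfl
      · rw [List.isChain_append]
        refine ⟨h3, List.isChain_singleton v, fun a ha b hb => ?_⟩
        rw [h2] at ha
        simp only [Option.mem_def, Option.some.injEq, List.head?_cons] at ha hb
        subst ha hb
        exact huv
      · exact (List.nodup_append_comm.1 (by simpa using ⟨hvp, h4⟩))
  · rcases hext v with h | ⟨u, p, hp, huv, hw, hpre, hL', hlt⟩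
    · exact hL.weight_le v p' (h ▸ hv)
    · obtain rfl : p ++ [v] = p' := by rw [hL'] at hv; exact Option.some.inj hv
      rwa [pathWeight_append_singleton lam hp.2.1]
  · rcases hext v with h | ⟨u, p, hp, huv, hw, hpre, hL', hlt⟩
    · exact (hle x).trans (hL.prefix_le v p' (h ▸ hv) q x hq hx)
    · obtain rfl : p ++ [v] = p' := by rw [hL'] at hv; exact Option.some.inj hv
      rcases List.prefix_concat_iff.1 hq with rfl | hq
      · obtain rfl : v = x := by simpa using hx
        rw [hL', entryCost_some]
      · exact (hle x).trans (hpre q x hq hx)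

end Tables

/-! ### Dijkstra's algorithm from arbitrary initial labels -/

section Dijkstra

variable {V : Type*} [FinEnum V] {E Z : Finset (V × V)} {c : V × V → ℝ≥0} {lam : V × V → ℕ}
  {s : V} {d : ℕ}

theorem dijkstraStep_entryCost_le (Z : Finset (V × V)) (c : V × V → ℝ≥0)
    (st : PathTable V × Finset V) (w : V) :
    entryCost c ((dijkstraStep Z c st).1 w) ≤ entryCost c (st.1 w) := by
  unfold dijkstraStep
  split
  · exact le_rfl
  · dsimp only
    split_ifs
    exacts [entryCost_better_le_left _ _, le_rfl]

theorem dijkstra_entryCost_le (Z : Finset (V × V)) (c : V × V → ℝ≥0) (L : PathTable V) (w : V) :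
    entryCost c (dijkstra Z c L w) ≤ entryCost c (L w) := by
  unfold dijkstra
  generalize FinEnum.card V = n
  induction n with
  | zero => exact le_rfl
  | succ n ih =>
    rw [Function.iterate_succ_apply']
    exact (dijkstraStep_entryCost_le Z c _ w).trans ih

theorem dijkstraStep_sound (hZ : ∀ x ∈ Z, x ∈ E ∧ lam x = 0) {st : PathTable V × Finset V}
    (hL : st.1.Sound E c lam s d) : (dijkstraStep Z c st).1.Sound E c lam s d := by
  refine hL.improve (dijkstraStep_entryCost_le Z c st) fun w => ?_
  unfold dijkstraStep
  split
  · exact .inl rfl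
  · rename_i u _
    dsimp only
    split_ifs with h
    · rcases better_eq_or (c := c) (st.1 w) (extend (st.1 u) w) with h1 | ⟨h1, h2⟩
      · exact .inl h1
      · right
        rcases hu : st.1 u with _ | p
        · simp [hu, extend, entryCost_none] at h2
        · refine ⟨u, p, hL.isSimplePath u p hu, (hZ _ h.2).1, ?_, hL.prefix_le u p hu, ?_, ?_⟩
          · rw [(hZ _ h.2).2]; exact hL.weight_le u p hu
          · rw [← hu, h1, hu]; rfl
          · rw [← hu, h1]; exact h2
    · exact .inl rfl

/-- The settled nodes have been relaxed, and their labels are at most those of the other nodes. -/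
def DijkstraInvariant (Z : Finset (V × V)) (c : V × V → ℝ≥0) (st : PathTable V × Finset V) :
    Prop :=
  (∀ u ∈ st.2, ∀ w, (u, w) ∈ Z →
    entryCost c (st.1 w) ≤ entryCost c (st.1 u) + (c (u, w) : ℝ≥0)) ∧
  ∀ u ∈ st.2, ∀ w ∉ st.2, entryCost c (st.1 u) ≤ entryCost c (st.1 w)

/-- Costs are nonnegative, so relaxing from a cheapest unsettled node `u` only creates labels at
least as large as that of `u`, which in turn dominates all settled labels. -/
theorem dijkstraStep_invariant {st : PathTable V × Finset V} (hL : st.1.Sound E c lam s d)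
    (h : DijkstraInvariant Z c st) : DijkstraInvariant Z c (dijkstraStep Z c st) := by
  have hle := dijkstraStep_entryCost_le Z c st
  obtain ⟨h1, h2⟩ := h
  revert hle
  unfold dijkstraStep
  split
  · exact fun _ => ⟨h1, h2⟩
  rename_i u hu
  intro hle
  dsimp only at hle
  have humem := List.argmin_mem hu
  simp only [List.mem_filter, FinEnum.mem_toList, true_and, decide_eq_true_eq] at humem
  -- The minimum is taken over labelled nodes only, but unlabelled ones have cost `⊤`.
  have hmin : ∀ w ∉ st.2, entryCost c (st.1 u) ≤ entryCost c (st.1 w) := by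
    intro w hw
    rcases hLw : st.1 w with _ | p
    · exact le_top
    · rw [← hLw]
      exact List.le_of_mem_argmin (f := fun u => entryCost c (st.1 u))
        (by simp [hw, hLw]) hu
  have hsame : ∀ w ∈ insert u st.2, (if w ∉ insert u st.2 ∧ (u, w) ∈ Z then
      better c (st.1 w) (extend (st.1 u) w) else st.1 w) = st.1 w := fun w hw => by simp [hw]
  constructor
  · intro v hv w hvw
    dsimp only at hv ⊢
    rw [hsame v hv]
    rcases Finset.mem_insert.1 hv with rfl | hv'
    · by_cases hw : w ∈ insert v st.2
      · rw [hsame w hw]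
        -- A node settled earlier is not relaxed again; its label is already at most that of `v`, by
        -- the second half of the invariant.
        rcases Finset.mem_insert.1 hw with rfl | hw
        · exact le_self_add
        · exact (h2 w hw v humem.1).trans le_self_add
      · rw [if_pos ⟨hw, hvw⟩, ← hL.entryCost_extend]
        exact entryCost_better_le_right _ _
    · exact (hle w).trans (h1 v hv' w hvw)
  · intro v hv w hw
    dsimp only at hv hw ⊢
    rw [hsame v hv]
    have hvu : entryCost c (st.1 v) ≤ entryCost c (st.1 u) := by
      rcases Finset.mem_insert.1 hv with rfl | hv'
      exacts [le_rfl, h2 v hv' u humem.1]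
    have hvw : entryCost c (st.1 v) ≤ entryCost c (st.1 w) :=
      hvu.trans (hmin w fun h => hw (Finset.mem_insert_of_mem h))
    split_ifs
    · refine le_entryCost_better hvw ?_
      rw [hL.entryCost_extend]
      exact hvu.trans le_self_add
    · exact hvw

theorem dijkstraStep_progress (Z : Finset (V × V)) (c : V × V → ℝ≥0)
    (st : PathTable V × Finset V) :
    (dijkstraStep Z c st = st ∧ ∀ u, (st.1 u).isSome → u ∈ st.2) ∨
      (dijkstraStep Z c st).2.card = st.2.card + 1 := by
  unfold dijkstraStep
  split
  · rename_i h
    rw [List.argmin_eq_none, List.filter_eq_nil_iff] at h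
    refine .inl ⟨rfl, fun u hu => ?_⟩
    by_contra hmem
    exact h u (FinEnum.mem_toList u) (by simp [hu, hmem])
  · rename_i u hu
    have humem := List.argmin_mem hu
    simp only [List.mem_filter, FinEnum.mem_toList, true_and, decide_eq_true_eq] at humem
    exact .inr (Finset.card_insert_of_notMem humem.1)

/-- Each step settles a new node unless all labelled nodes are settled. After `FinEnum.card V` steps
all labelled nodes are settled in either case, and the invariant gives the inequality for every edge
of `Z`; from an unlabelled node it is trivial. -/
theorem dijkstra_sound_and_relaxed (hZ : ∀ x ∈ Z, x ∈ E ∧ lam x = 0) {L : PathTable V}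
    (hL : L.Sound E c lam s d) :
    (dijkstra Z c L).Sound E c lam s d ∧ ∀ u w, (u, w) ∈ Z →
      entryCost c (dijkstra Z c L w) ≤ entryCost c (dijkstra Z c L u) + (c (u, w) : ℝ≥0) := by
  have key : ∀ n, let st := (dijkstraStep Z c)^[n] (L, ∅)
      st.1.Sound E c lam s d ∧ DijkstraInvariant Z c st ∧
        ((∀ u, (st.1 u).isSome → u ∈ st.2) ∨ n ≤ st.2.card) := by
    intro n
    induction n with
    | zero => exact ⟨hL, ⟨by simp, by simp⟩, .inr (Nat.zero_le _)⟩
    | succ n ih =>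
      dsimp only at ih ⊢
      rw [Function.iterate_succ_apply']
      obtain ⟨h1, h2, h3⟩ := ih
      refine ⟨dijkstraStep_sound hZ h1, dijkstraStep_invariant h1 h2, ?_⟩
      rcases dijkstraStep_progress Z c ((dijkstraStep Z c)^[n] (L, ∅)) with ⟨h, h'⟩ | h
      · rw [h]; exact .inl h'
      · rcases h3 with h3 | h3
        · left
          -- With all labelled nodes settled there is no candidate left, so the settled set cannot
          -- have grown.
          by_contra hcon
          unfold dijkstraStep at h hcon
          split at h
          · omega
          · rename_i u hu
            have humem := List.argmin_mem hu
            simp only [List.mem_filter, FinEnum.mem_toList, true_and, decide_eq_true_eq] at humem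
            exact humem.1 (h3 u humem.2)
        · right; omega
  obtain ⟨h1, h2, h3⟩ := key (FinEnum.card V)
  refine ⟨h1, fun u w huw => ?_⟩
  have hsettled : ∀ u, (dijkstra Z c L u).isSome →
      u ∈ ((dijkstraStep Z c)^[FinEnum.card V] (L, ∅)).2 := by
    rcases h3 with h3 | h3
    · exact h3
    · intro u _
      have : ((dijkstraStep Z c)^[FinEnum.card V] (L, ∅)).2 = Finset.univ := by
        apply Finset.eq_univ_of_card
        refine le_antisymm (Finset.card_le_univ _) ?_
        rwa [← FinEnum.card_eq_fintypeCard]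
      rw [this]; exact Finset.mem_univ u
  rcases hu : dijkstra Z c L u with _ | p
  · simp [entryCost_none]
  · rw [← hu]
    exact h2.1 u (hsettled u (by simp [hu])) w huw

end Dijkstra

/-! ### The dynamic program over integer budgets -/

section Layer

variable {V : Type*} [FinEnum V] {E : Finset (V × V)} {c : V × V → ℝ≥0} {lam : V × V → ℕ}
  {s : V}

/-- The labels from which the table for the budget `d` is computed by improvements. -/
noncomputable def layerStart (E : Finset (V × V)) (c : V × V → ℝ≥0) (lam : V × V → ℕ) (s : V)
    (d : ℕ) : PathTable V :=
  fun v => if 0 < d then layer E c lam s (d - 1) v else if v = s then some [s] else none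

/-- The labels for the budget `d` after the extensions by edges of positive latency. -/
noncomputable def layerExtended (E : Finset (V × V)) (c : V × V → ℝ≥0) (lam : V × V → ℕ) (s : V)
    (d : ℕ) : PathTable V :=
  fun v => (FinEnum.toList V).foldl
      (fun best u =>
        if _h : (u, v) ∈ E ∧ 0 < lam (u, v) ∧ lam (u, v) ≤ d then
          better c best (extend (layer E c lam s (d - lam (u, v)) u) v)
        else best) (layerStart E c lam s d v)

theorem layer_eq (d : ℕ) : layer E c lam s d =
    dijkstra (E.filter fun x => lam x = 0) c (layerExtended E c lam s d) := by
  rw [layer]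
  rfl

theorem layerExtended_spec (d : ℕ) (v : V) :
    entryCost c (layerExtended E c lam s d v) ≤ entryCost c (layerStart E c lam s d v) ∧
    (∀ u, (u, v) ∈ E ∧ 0 < lam (u, v) ∧ lam (u, v) ≤ d →
      entryCost c (layerExtended E c lam s d v) ≤
        entryCost c (extend (layer E c lam s (d - lam (u, v)) u) v)) ∧
    (layerExtended E c lam s d v = layerStart E c lam s d v ∨
      ∃ u, ((u, v) ∈ E ∧ 0 < lam (u, v) ∧ lam (u, v) ≤ d) ∧
        layerExtended E c lam s d v = extend (layer E c lam s (d - lam (u, v)) u) v ∧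
        entryCost c (layerExtended E c lam s d v) < entryCost c (layerStart E c lam s d v)) := by
  obtain ⟨h1, h2, h3⟩ := foldl_better_spec (c := c) (FinEnum.toList V)
    (fun u => (u, v) ∈ E ∧ 0 < lam (u, v) ∧ lam (u, v) ≤ d)
    (fun u => extend (layer E c lam s (d - lam (u, v)) u) v) (layerStart E c lam s d v)
  exact ⟨h1, fun u hu => h2 u (FinEnum.mem_toList u) hu, h3⟩

theorem entryCost_layer_le_extended (d : ℕ) (v : V) :
    entryCost c (layer E c lam s d v) ≤ entryCost c (layerExtended E c lam s d v) := by
  rw [layer_eq]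
  exact dijkstra_entryCost_le _ c _ v

theorem entryCost_layer_antitone (v : V) :
    Antitone fun d => entryCost c (layer E c lam s d v) :=
  antitone_nat_of_succ_le fun d => (entryCost_layer_le_extended (d + 1) v).trans
    ((layerExtended_spec (d + 1) v).1.trans (by simp [layerStart]))

/-- The extended paths come from tables of other budgets, so their initial segments must be compared
with the current starting labels. Monotonicity in the budget makes this possible. -/
theorem layerExtended_sound {d : ℕ}
    (ih : ∀ d' < d, (layer E c lam s d').Sound E c lam s d') :
    (layerExtended E c lam s d).Sound E c lam s d := by
  have hstart : (layerStart E c lam s d).Sound E c lam s d := by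
    rcases Nat.eq_zero_or_pos d with rfl | hd
    · have heq : layerStart E c lam s 0 = fun v => if v = s then some [s] else none := by
        funext v; simp [layerStart]
      rw [heq]
      refine ⟨fun v p hv => ?_, fun v p hv => ?_, fun v p hv q x hq hx => ?_⟩ <;>
        split_ifs at hv with h <;> obtain rfl := Option.some.inj hv
      · subst h
        exact ⟨rfl, rfl, List.isChain_singleton _, by simp⟩
      · simp [pathWeight_singleton]
      · have : x = s := by simpa using hq.subset (List.mem_of_getLast? hx)
        simp [this, entryCost_some, pathWeight_singleton]
    · have heq : layerStart E c lam s d = layer E c lam s (d - 1) := by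
        funext v; simp [layerStart, hd]
      rw [heq]
      have h := ih (d - 1) (by omega)
      exact ⟨h.1, fun v p hv => (h.2 v p hv).trans (by omega), h.3⟩
  refine hstart.improve (fun w => (layerExtended_spec d w).1) fun w => ?_
  rcases (layerExtended_spec (E := E) (c := c) (lam := lam) (s := s) d w).2.2
    with h | ⟨u, ⟨huw, hpos, hle⟩, heq, hlt⟩
  · exact .inl h
  · right
    have hs := ih (d - lam (u, w)) (by omega)
    rcases hu : layer E c lam s (d - lam (u, w)) u with _ | p
    · simp [heq, hu, extend, entryCost_none] at hlt
    · refine ⟨u, p, hs.isSimplePath u p hu, huw, ?_, fun q x hq hx => ?_, ?_, hlt⟩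
      · have := hs.weight_le u p hu
        omega
      -- As `lam (u, w)` is positive, `p` was stored for a budget at most `d - 1`, and the starting
      -- labels are those of budget `d - 1`.
      · refine le_trans ?_ (hs.prefix_le u p hu q x hq hx)
        rw [layerStart, if_pos (by omega)]
        exact entryCost_layer_antitone x (by omega)
      · rw [heq, hu]; rfl

theorem layer_sound (d : ℕ) : (layer E c lam s d).Sound E c lam s d := by
  induction d using Nat.strong_induction_on with
  | _ d ih =>
    rw [layer_eq]
    exact (dijkstra_sound_and_relaxed (by simp) (layerExtended_sound ih)).1

/-- An edge of latency zero is relaxed by Dijkstra's algorithm inside the layer, an edge of positive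
latency by the extension from an earlier layer. -/
theorem entryCost_layer_le_of_edge {d : ℕ} {u v : V} (huv : (u, v) ∈ E) (hd : lam (u, v) ≤ d) :
    entryCost c (layer E c lam s d v) ≤
      entryCost c (layer E c lam s (d - lam (u, v)) u) + (c (u, v) : ℝ≥0) := by
  rcases Nat.eq_zero_or_pos (lam (u, v)) with h | h
  · rw [h, Nat.sub_zero, layer_eq]
    exact (dijkstra_sound_and_relaxed (by simp)
      (layerExtended_sound fun d' _ => layer_sound d')).2 u v (by simp [huv, h])
  · rw [← (layer_sound _).entryCost_extend]
    exact (entryCost_layer_le_extended d v).trans ((layerExtended_spec d v).2.1 u ⟨huv, h, hd⟩)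

/-- Induction on the last edge, which uses up its own latency from the budget. The comparison path
need not be simple. -/
theorem entryCost_layer_le {p : List V} {d : ℕ} {v : V} (hs : p.head? = some s)
    (hv : p.getLast? = some v) (hc : p.IsChain fun u v => (u, v) ∈ E)
    (hd : pathWeight lam p ≤ d) :
    entryCost c (layer E c lam s d v) ≤ (pathWeight c p : ℝ≥0) := by
  induction p using List.reverseRecOn generalizing d v with
  | nil => simp at hs
  | append_singleton p w ih =>
    obtain rfl : w = v := by simpa using hv
    rcases hp : p.getLast? with _ | u
    · rw [List.getLast?_eq_none_iff] at hp
      subst hp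
      obtain rfl : w = s := by simpa using hs
      refine (entryCost_layer_antitone w (Nat.zero_le d)).trans ?_
      refine (entryCost_layer_le_extended 0 w).trans ((layerExtended_spec 0 w).1.trans ?_)
      simp [layerStart, entryCost_some]
    · rw [pathWeight_append_singleton lam hp] at hd
      rw [List.isChain_append] at hc
      have huw : (u, w) ∈ E := hc.2.2 u hp w (by simp)
      have hs' : p.head? = some s := by
        rw [List.head?_append] at hs
        cases p with
        | nil => simp at hp
        | cons a l => simpa using hs
      refine (entryCost_layer_le_of_edge huw (by omega)).trans ?_
      rw [pathWeight_append_singleton c hp, ENNReal.coe_add]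
      gcongr
      exact ih hs' hp hc.1 (by omega)

end Layer

/-! ### Rounding errors of the scaled latencies -/

section ScaledLatency

variable {V : Type*} {T : ℝ≥0} {l : V × V → ℝ≥0} {τ : ℕ}

theorem sum_scaledLatency_le (hT : T ≠ 0) (L : List (V × V)) :
    (((L.map (scaledLatency T l τ)).sum : ℕ) : ℝ≥0) ≤ (L.map l).sum * τ / T := by
  induction L with
  | nil => simp
  | cons x L ih =>
    simp only [List.map_cons, List.sum_cons, Nat.cast_add, add_mul, add_div]
    gcongr
    rw [scaledLatency, if_neg hT]
    exact Nat.floor_le (zero_le)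

theorem sum_latency_le (hT : T ≠ 0) (L : List (V × V)) :
    (L.map l).sum * τ / T ≤ (((L.map (scaledLatency T l τ)).sum : ℕ) : ℝ≥0) + L.length := by
  induction L with
  | nil => simp
  | cons x L ih =>
    simp only [List.map_cons, List.sum_cons, Nat.cast_add, add_mul, add_div, List.length_cons,
      Nat.cast_one]
    rw [show ∀ a b c d : ℝ≥0, a + b + (c + d) = (a + d) + (b + c) by intros; ring]
    gcongr
    rw [scaledLatency, if_neg hT]
    exact (Nat.lt_floor_add_one _).le

/-- A single edge of positive latency has the value `τ + 1` and already exceeds the budget. -/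
theorem sum_latency_eq_zero (hT : T = 0) (L : List (V × V))
    (h : (L.map (scaledLatency T l τ)).sum ≤ τ) : (L.map l).sum = 0 := by
  refine List.sum_eq_zero fun y hy => ?_
  obtain ⟨x, hx, rfl⟩ := List.mem_map.1 hy
  have := List.single_le_sum (fun _ _ => Nat.zero_le _) _
    (List.mem_map_of_mem (f := scaledLatency T l τ) hx)
  by_contra hne
  rw [scaledLatency, if_pos hT, if_neg hne] at this
  omega

theorem pathWeight_scaledLatency_le {p : List V} (h : pathWeight l p ≤ T) :
    pathWeight (scaledLatency T l τ) p ≤ τ := by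
  by_cases hT : T = 0
  · subst hT
    refine le_trans (List.sum_eq_zero fun y hy => ?_).le (Nat.zero_le τ)
    obtain ⟨x, hx, rfl⟩ := List.mem_map.1 hy
    have := List.single_le_sum (fun _ _ => zero_le) _ (List.mem_map_of_mem (f := l) hx)
    have hx0 : l x = 0 := nonpos_iff_eq_zero.1 (this.trans h)
    simp [scaledLatency, hx0]
  · have h1 := sum_scaledLatency_le (l := l) (τ := τ) hT (pathEdges p)
    have h2 : (pathWeight l p) * τ / T ≤ τ := by
      rw [div_le_iff₀ (pos_iff_ne_zero.2 hT), mul_comm]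
      gcongr
    exact_mod_cast h1.trans h2

/-- In units of `T / τ`, rounding loses at most one per edge, hence at most `p.length ≤ ε * τ` on
top of the budget `τ`. -/
theorem pathWeight_latency_le {ε : ℝ≥0} {p : List V} (hτ : 0 < τ) (hp : p.length ≤ ε * τ)
    (h : pathWeight (scaledLatency T l τ) p ≤ τ) : pathWeight l p ≤ (1 + ε) * T := by
  by_cases hT : T = 0
  · rw [pathWeight, sum_latency_eq_zero hT _ h]
    exact zero_le
  · have hT' := pos_iff_ne_zero.2 hT
    have hτ' : (0 : ℝ≥0) < τ := by exact_mod_cast hτ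
    have h1 := sum_latency_le (l := l) (τ := τ) hT (pathEdges p)
    have h2 : pathWeight l p * τ / T ≤ τ + ε * τ := by
      refine h1.trans (add_le_add (by exact_mod_cast h) (le_trans ?_ hp))
      exact_mod_cast length_pathEdges_le p
    rw [div_le_iff₀ hT'] at h2
    refine le_of_mul_le_mul_right (h2.trans_eq ?_) hτ'
    ring

end ScaledLatency

/-! ### Termination and quality of the restricted shortest paths -/

section Goel

variable {V : Type*} [FinEnum V]

/-- Goel et al.'s algorithm terminates, its paths satisfy the approximate latency bound, and they
are at most as expensive as all paths that satisfy the strict bound. -/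
theorem goel_spec (E : Finset (V × V)) (c l : V × V → ℝ≥0) (T : ℝ≥0) {ε : ℝ≥0} (hε : 0 < ε)
    (s : V) : ∃ P, goel E c l T ε s = Part.some P ∧
      ∀ t, (∀ p, P t = some p → IsSimplePath E s t p ∧ pathWeight l p ≤ (1 + ε) * T) ∧
        ∀ p, IsSimplePath E s t p → pathWeight l p ≤ T →
          entryCost c (P t) ≤ (pathWeight c p : ℝ≥0) := by
  have hdom : (goel E c l T ε s).Dom := by
    unfold goel
    rw [Nat.rfindOpt_dom]
    -- A simple path has at most `|V|` nodes, so a resolution `2 ^ k > |V| / ε` passes the test.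
    obtain ⟨k, hk⟩ := pow_unbounded_of_one_lt ((FinEnum.card V : ℝ≥0) / ε) one_lt_two
    refine ⟨k, layer E c (scaledLatency T l (2 ^ k)) s (2 ^ k), ?_⟩
    dsimp only
    rw [if_pos]
    · rfl
    intro t
    rw [Option.all_eq_true]
    intro p hp
    have hs := layer_sound (E := E) (c := c) (lam := scaledLatency T l (2 ^ k)) (s := s) (2 ^ k)
    refine decide_eq_true (pathWeight_latency_le (by positivity) ?_ (hs.weight_le t p hp))
    have hlen : (p.length : ℝ≥0) ≤ FinEnum.card V := by
      rw [FinEnum.card_eq_fintypeCard]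
      exact_mod_cast (hs.isSimplePath t p hp).2.2.2.length_le_card
    rw [div_lt_iff₀ hε] at hk
    push_cast
    exact hlen.trans (hk.le.trans_eq (mul_comm _ _))
  refine ⟨(goel E c l T ε s).get hdom, (Part.some_get hdom).symm, fun t => ?_⟩
  -- The search may stop at a different `k`. There the latency bound is the acceptance test itself,
  -- and the cost bound holds at every resolution.
  obtain ⟨k, hk⟩ := Nat.rfindOpt_spec (Part.get_mem hdom)
  dsimp only at hk
  split_ifs at hk with hall
  · have hP := Option.some.inj hk
    rw [← hP]
    have hs := layer_sound (E := E) (c := c) (lam := scaledLatency T l (2 ^ k)) (s := s) (2 ^ k)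
    refine ⟨fun p hp => ⟨hs.isSimplePath t p hp, ?_⟩, fun p hp hl => ?_⟩
    · have := hall t
      rw [Option.all_eq_true] at this
      exact of_decide_eq_true (this p hp)
    · exact entryCost_layer_le hp.1 hp.2.1 hp.2.2.1 (pathWeight_scaledLatency_le hl)
  · cases hk

theorem runAll_eq_some {ι α : Type*} {f : ι → Part α} {g : ι → α} (h : ∀ i, f i = Part.some (g i)) :
    runAll f = Part.some g := by
  obtain rfl : f = fun i => Part.some (g i) := funext h
  exact Part.eq_some_iff.2 ⟨fun _ => trivial, rfl⟩

theorem aprspGoel_spec (E : Finset (V × V)) (c l : V × V → ℝ≥0) (T : ℝ≥0) {ε : ℝ≥0} (hε : 0 < ε) :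
    ∃ P, aprspGoel E c l T ε = Part.some P ∧
      ∀ s t, (∀ p, P s t = some p → IsSimplePath E s t p ∧ pathWeight l p ≤ (1 + ε) * T) ∧
        ∀ p, IsSimplePath E s t p → pathWeight l p ≤ T →
          entryCost c (P s t) ≤ (pathWeight c p : ℝ≥0) := by
  choose P hP hspec using goel_spec E c l T hε
  exact ⟨P, runAll_eq_some hP, hspec⟩

end Goel

/-! ### Bags and edges in tree decompositions -/

namespace BagTree

variable {W : Type*}

theorem rootBag_mem_bags (t : BagTree W) : t.rootBag ∈ t.bags := by
  cases t
  exact Set.mem_insert _ _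

theorem mem_bags_node {B : Finset W} {k : ℕ} {child : Fin k → BagTree W} {A : Finset W} :
    A ∈ (node B k child).bags ↔ A = B ∨ ∃ j, A ∈ (child j).bags := by
  simp [bags]

theorem occurs_node {B : Finset W} {k : ℕ} {child : Fin k → BagTree W} {i : W} :
    (node B k child).Occurs i ↔ i ∈ B ∨ ∃ j, (child j).Occurs i := by
  simp only [Occurs, mem_bags_node]
  constructor
  · rintro ⟨A, rfl | ⟨j, hA⟩, hi⟩
    exacts [.inl hi, .inr ⟨j, A, hA, hi⟩]
  · rintro (hi | ⟨j, A, hA, hi⟩)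
    exacts [⟨B, .inl rfl, hi⟩, ⟨A, .inr ⟨j, hA⟩, hi⟩]

/-- Every edge between nodes that occur in the tree lies in a bag of the tree. -/
def CoversEdges (t : BagTree W) (E : Finset (W × W)) : Prop :=
  ∀ e ∈ E, t.Occurs e.1 → t.Occurs e.2 → ∃ B ∈ t.bags, e.1 ∈ B ∧ e.2 ∈ B

/-- If the covering bag lies outside the child, connectedness forces both end points into `B` and
then into the child's root bag, which covers the edge instead. -/
theorem CoversEdges.child {B : Finset W} {k : ℕ} {child : Fin k → BagTree W} {E : Finset (W × W)}
    (hc : (node B k child).Connected) (h : (node B k child).CoversEdges E) (j : Fin k) :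
    (child j).CoversEdges E := by
  obtain ⟨h1, h2, -⟩ := hc
  intro e he ho ho'
  obtain ⟨A, hA, h3, h4⟩ := h e he (occurs_node.2 (.inr ⟨j, ho⟩)) (occurs_node.2 (.inr ⟨j, ho'⟩))
  rcases mem_bags_node.1 hA with rfl | ⟨j', hA⟩
  · exact ⟨_, rootBag_mem_bags _, h1 j _ h3 ho, h1 j _ h4 ho'⟩
  · by_cases hj : j = j'
    · subst hj; exact ⟨A, hA, h3, h4⟩
    · exact ⟨_, rootBag_mem_bags _, h1 j _ (h2 j j' hj _ ho ⟨A, hA, h3⟩) ho,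
        h1 j _ (h2 j j' hj _ ho' ⟨A, hA, h4⟩) ho'⟩

end BagTree

/-! ### Additivity of the cost over a bag and its subtrees -/

section Restriction

variable {W V : Type*}

open Classical in
/-- The restriction of a partial mapping to a set. -/
noncomputable def restrict (X : Set W) (f : W → Option V) : W → Option V :=
  fun i => if i ∈ X then f i else none

theorem restrict_of_mem {X : Set W} {f : W → Option V} {i : W} (h : i ∈ X) :
    restrict X f i = f i := if_pos h

theorem restrict_of_notMem {X : Set W} {f : W → Option V} {i : W} (h : i ∉ X) :
    restrict X f i = none := if_neg h

theorem restrict_congr {X : Set W} {f g : W → Option V} (h : ∀ i ∈ X, f i = g i) :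
    restrict X f = restrict X g := by
  funext i
  by_cases hi : i ∈ X
  · rw [restrict_of_mem hi, restrict_of_mem hi, h i hi]
  · rw [restrict_of_notMem hi, restrict_of_notMem hi]

theorem eq_restrict {X : Set W} {f g : W → Option V} (hf : ∀ i ∉ X, f i = none)
    (h : ∀ i ∈ X, f i = g i) : f = restrict X g := by
  funext i
  by_cases hi : i ∈ X
  · rw [restrict_of_mem hi, h i hi]
  · rw [restrict_of_notMem hi, hf i hi]

-- Inclusion-exclusion for a single item of cost `a`: outside `b` it belongs to at most one `x j`.
-- Overlaps are added on the left because subtraction in `ℝ≥0` is truncated.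
open Classical in
theorem ite_add_sum_ite {ι : Type*} [Fintype ι] (a : ℝ≥0) {y b : Prop} {x : ι → Prop}
    (hy : y ↔ b ∨ ∃ j, x j) (hx : ∀ j j', x j → x j' → j ≠ j' → b) :
    (if y then a else 0) + ∑ j, (if b ∧ x j then a else 0) =
      (if b then a else 0) + ∑ j, if x j then a else 0 := by
  by_cases hb : b
  · simp [hy, hb]
  · by_cases hex : ∃ j, x j
    · obtain ⟨j, hj⟩ := hex
      have : ∀ j', x j' ↔ j' = j := fun j' =>
        ⟨fun h => by_contra fun hne => hb (hx j' j h hj hne), fun h => h ▸ hj⟩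
      simp [hy, hb, this]
    · have : ∀ j, ¬ x j := fun j hj => hex ⟨j, hj⟩
      simp [hy, hb, this]

variable [FinEnum W]

open Classical in
theorem partialCost_restrict (S : Substrate V) (R : Request W V)
    (P : R.edges → V → V → Option (List V)) (X : Set W) (f : W → Option V) :
    partialCost S R P (restrict X f) =
      ∑ i, (if i ∈ X then (match f i with
        | some u => R.nodeDemand i * S.nodeCost u
        | none => 0) else 0) +
      ∑ e : R.edges, (if e.1.1 ∈ X ∧ e.1.2 ∈ X then (match f e.1.1, f e.1.2 with
        | some u, some w => R.edgeDemand e.1 * (P e u w).elim 0 (pathWeight S.edgeCost)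
        | _, _ => 0) else 0) := by
  unfold partialCost
  congr 1
  · refine Finset.sum_congr rfl fun i _ => ?_
    by_cases hi : i ∈ X
    · rw [restrict_of_mem hi, if_pos hi]
    · rw [restrict_of_notMem hi, if_neg hi]
  · refine Finset.sum_congr rfl fun e _ => ?_
    by_cases h1 : e.1.1 ∈ X
    · by_cases h2 : e.1.2 ∈ X
      · rw [restrict_of_mem h1, restrict_of_mem h2, if_pos ⟨h1, h2⟩]
      · rw [restrict_of_notMem h2, if_neg fun h => h2 h.2]
        rcases restrict X f e.1.1 with _ | u <;> rfl
    · rw [restrict_of_notMem h1, if_neg fun h => h1 h.1]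

/-- The cost of a partial mapping is additive over a set `B` and sets that overlap only inside `B`,
up to the cost of the overlaps with `B`. -/
theorem partialCost_restrict_union (S : Substrate V) (R : Request W V)
    (P : R.edges → V → V → Option (List V)) {ι : Type*} [Fintype ι] {B : Set W} {X : ι → Set W}
    (hX : ∀ j j', j ≠ j' → ∀ i, i ∈ X j → i ∈ X j' → i ∈ B)
    (hE : ∀ e ∈ R.edges, e.1 ∈ B ∪ ⋃ j, X j → e.2 ∈ B ∪ ⋃ j, X j →
      (e.1 ∈ B ∧ e.2 ∈ B) ∨ ∃ j, e.1 ∈ X j ∧ e.2 ∈ X j) (f : W → Option V) :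
    partialCost S R P (restrict (B ∪ ⋃ j, X j) f) +
        ∑ j, partialCost S R P (restrict (B ∩ X j) f) =
      partialCost S R P (restrict B f) + ∑ j, partialCost S R P (restrict (X j) f) := by
  classical
  simp only [partialCost_restrict, Finset.sum_add_distrib]
  -- Separate node costs from edge costs; after interchanging sums, each request node and each
  -- request edge is an instance of `ite_add_sum_ite`.
  refine (add_add_add_comm _ _ _ _).trans (Eq.trans ?_ (add_add_add_comm _ _ _ _).symm)
  congr 1
  · rw [Finset.sum_comm (s := Finset.univ (α := ι)), Finset.sum_comm (s := Finset.univ (α := ι)), ← Finset.sum_add_distrib,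
      ← Finset.sum_add_distrib]
    refine Finset.sum_congr rfl fun i _ => ?_
    convert ite_add_sum_ite _ (y := i ∈ B ∪ ⋃ j, X j) (b := i ∈ B) (x := fun j => i ∈ X j)
      (by simp) fun j j' h h' hne => hX j j' hne i h h'
    exact Set.mem_inter_iff _ _ _
  · rw [Finset.sum_comm (s := Finset.univ (α := ι)), Finset.sum_comm (s := Finset.univ (α := ι)), ← Finset.sum_add_distrib,
      ← Finset.sum_add_distrib]
    refine Finset.sum_congr rfl fun e _ => ?_
    have := ite_add_sum_ite (match f e.1.1, f e.1.2 with
        | some u, some w => R.edgeDemand e.1 * (P e u w).elim 0 (pathWeight S.edgeCost)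
        | _, _ => 0) (y := e.1.1 ∈ B ∪ ⋃ j, X j ∧ e.1.2 ∈ B ∪ ⋃ j, X j)
        (b := e.1.1 ∈ B ∧ e.1.2 ∈ B) (x := fun j => e.1.1 ∈ X j ∧ e.1.2 ∈ X j)
        ⟨fun h => hE e.1 e.2 h.1 h.2, ?_⟩
        fun j j' h h' hne => ⟨hX j j' hne _ h.1 h'.1, hX j j' hne _ h.2 h'.2⟩
    · simp only [Set.mem_inter_iff, and_and_and_comm (b := e.1.1 ∈ X _)]
      convert this
    · rintro (h | ⟨j, h⟩)
      · exact ⟨.inl h.1, .inl h.2⟩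
      · exact ⟨.inr (Set.mem_iUnion.2 ⟨j, h.1⟩), .inr (Set.mem_iUnion.2 ⟨j, h.2⟩)⟩

end Restriction

/-! ### Correctness of the tables of DynVMP -/

section BagOK

variable {W V : Type*} {S : Substrate V} {R : Request W V}
  {P : R.edges → V → V → Option (List V)}

theorem BagOK.congr {B : Finset W} {f g : W → Option V} (h : BagOK S R P B f)
    (hfg : ∀ i ∈ B, f i = g i) : BagOK S R P B g := by
  refine ⟨fun i hi => hfg i hi ▸ h.1 i hi, fun e h1 h2 => ?_⟩
  rw [← hfg _ h1, ← hfg _ h2]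
  exact h.2 e h1 h2

end BagOK

section DynTable

variable {W V : Type*} [FinEnum W] [FinEnum V] {S : Substrate V} {R : Request W V}
  {P : R.edges → V → V → Option (List V)}

theorem mem_bagMappings {B : Finset W} {f : W → Option V} :
    f ∈ bagMappings V B ↔ ∀ i, (f i).isSome ↔ i ∈ B := by
  simp only [bagMappings, List.mem_map, FinEnum.mem_toList, true_and]
  constructor
  · rintro ⟨g, rfl⟩ i
    by_cases h : i ∈ B <;> simp [h]
  · intro h
    refine ⟨fun i => (f i).get ((h i).2 i.2), ?_⟩
    funext i
    by_cases hi : i ∈ B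
    · simp [hi]
    · simp only [hi, dite_false]
      have := (h i).not.2 hi
      exact (Option.not_isSome_iff_eq_none.1 this).symm

open Classical in
/-- The entry of the table of `t` that is selected for the mapping `f` of the parent's bag `B`. -/
noncomputable def bestEntry (S : Substrate V) (R : Request W V)
    (P : R.edges → V → V → Option (List V)) (B : Finset W) (f : W → Option V) (t : BagTree W) :
    Option (W → Option V) :=
  (((bagMappings V t.rootBag).filter
      (fun g => ∀ i ∈ B ∩ t.rootBag, g i = f i)).filterMap
    (fun g => dynTable S R P t g)).argmin (partialCost S R P)

/-- Join a bag mapping with mappings for the subtrees. -/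
def joinMappings {k : ℕ} (f : W → Option V) (g : Fin k → W → Option V) : W → Option V :=
  fun i => (f i).or ((List.finRange k).findSome? fun j => g j i)

theorem dynTable_node_eq_some {B : Finset W} {k : ℕ} {child : Fin k → BagTree W}
    {f r : W → Option V} :
    dynTable S R P (.node B k child) f = some r ↔
      BagOK S R P B f ∧ ∃ g : Fin k → W → Option V,
        (∀ j, bestEntry S R P B f (child j) = some (g j)) ∧ r = joinMappings f g := by
  have hjoin : ∀ g : Fin k → W → Option V, (∀ j, bestEntry S R P B f (child j) = some (g j)) →
      (fun i => (f i).or ((List.finRange k).findSome? fun j =>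
        (bestEntry S R P B f (child j)).bind fun g => g i)) = joinMappings f g := by
    intro g hg
    funext i
    simp [joinMappings, hg]
  have heq : dynTable S R P (.node B k child) f =
      open Classical in
      if BagOK S R P B f ∧ ∀ j, (bestEntry S R P B f (child j)).isSome then
        some fun i => (f i).or ((List.finRange k).findSome? fun j =>
          (bestEntry S R P B f (child j)).bind fun g => g i)
      else none := by
    rw [dynTable]; rfl
  rw [heq]
  constructor
  · intro h
    split_ifs at h with hc
    refine ⟨hc.1, fun j => (bestEntry S R P B f (child j)).get (hc.2 j), fun j => by simp, ?_⟩
    rw [← Option.some.inj h]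
    exact hjoin _ fun j => by simp
  · rintro ⟨h1, g, h2, rfl⟩
    rw [if_pos ⟨h1, fun j => by simp [h2]⟩, hjoin g h2]

theorem mem_entries {B : Finset W} {f g : W → Option V} {t : BagTree W}
    (h : bestEntry S R P B f t = some g) :
    ∃ g₀ ∈ bagMappings V t.rootBag, (∀ i ∈ B, i ∈ t.rootBag → g₀ i = f i) ∧
      dynTable S R P t g₀ = some g := by
  have := List.argmin_mem h
  simp only [List.mem_filterMap, List.mem_filter, decide_eq_true_eq, Finset.mem_inter] at this
  obtain ⟨g₀, ⟨h1, h2⟩, h3⟩ := this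
  exact ⟨g₀, h1, fun i hi hi' => h2 i ⟨hi, hi'⟩, h3⟩

theorem exists_bestEntry {B : Finset W} {f g₀ g' : W → Option V} {t : BagTree W}
    (h1 : g₀ ∈ bagMappings V t.rootBag) (h2 : ∀ i ∈ B, i ∈ t.rootBag → g₀ i = f i)
    (h3 : dynTable S R P t g₀ = some g') :
    ∃ g, bestEntry S R P B f t = some g ∧ partialCost S R P g ≤ partialCost S R P g' := by
  classical
  have hmem : g' ∈ ((bagMappings V t.rootBag).filter
      (fun g => ∀ i ∈ B ∩ t.rootBag, g i = f i)).filterMap (fun g => dynTable S R P t g) := by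
    simp only [List.mem_filterMap, List.mem_filter, decide_eq_true_eq, Finset.mem_inter]
    exact ⟨g₀, ⟨h1, fun i hi => h2 i hi.1 hi.2⟩, h3⟩
  rcases hb : bestEntry S R P B f t with _ | g
  · rw [bestEntry, List.argmin_eq_none] at hb
    have : g' ∈ ([] : List (W → Option V)) := by
      rw [← hb]; convert hmem
    simp at this
  · refine ⟨g, rfl, List.le_of_mem_argmin (f := partialCost S R P) ?_ hb⟩
    convert hmem

/-- `g` maps exactly the nodes that occur in `t`, and it is valid on each bag of `t`. -/
def IsSubtreeSolution (S : Substrate V) (R : Request W V)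
    (P : R.edges → V → V → Option (List V)) (t : BagTree W) (g : W → Option V) : Prop :=
  (∀ i, (g i).isSome ↔ t.Occurs i) ∧ ∀ B ∈ t.bags, BagOK S R P B g

theorem joinMappings_of_mem {B : Finset W} {k : ℕ} {f : W → Option V} (hf : f ∈ bagMappings V B)
    (g : Fin k → W → Option V) {i : W} (hi : i ∈ B) : joinMappings f g i = f i := by
  have := (mem_bagMappings.1 hf i).2 hi
  obtain ⟨u, hu⟩ := Option.isSome_iff_exists.1 this
  simp [joinMappings, hu]

/-- The join takes the first available value, but there is no conflict: a node of `B` that occurs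
below a child is in the child's root bag, where the mappings agree, and any other node occurs below
one child only. -/
theorem joinMappings_of_occurs {B : Finset W} {k : ℕ} {child : Fin k → BagTree W}
    (hc : (BagTree.node B k child).Connected) {f : W → Option V} (hf : f ∈ bagMappings V B)
    {g : Fin k → W → Option V} (hg : ∀ j i, (g j i).isSome ↔ (child j).Occurs i)
    (hgf : ∀ j, ∀ i ∈ B, i ∈ (child j).rootBag → g j i = f i) {j : Fin k} {i : W}
    (hi : (child j).Occurs i) : joinMappings f g i = g j i := by
  by_cases hB : i ∈ B
  · rw [joinMappings_of_mem hf g hB, hgf j i hB (hc.1 j i hB hi)]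
  · have hfi : f i = none := by
      simpa using (mem_bagMappings.1 hf i).not.2 hB
    have huniq : ∀ j', (g j' i).isSome → j' = j := fun j' h =>
      by_contra fun hne => hB (hc.2.1 j' j hne i ((hg j' i).1 h) hi)
    obtain ⟨u, hu⟩ := Option.isSome_iff_exists.1 ((hg j i).2 hi)
    rw [joinMappings, hfi, Option.none_or]
    rcases hfs : (List.finRange k).findSome? (fun j => g j i) with _ | w
    · rw [List.findSome?_eq_none_iff] at hfs
      rw [hfs j (List.mem_finRange j)]
    · obtain ⟨j', -, hj'⟩ := List.exists_of_findSome?_eq_some hfs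
      obtain rfl := huniq j' (by simp [hj'])
      exact hj'.symm

theorem joinMappings_isSome {B : Finset W} {k : ℕ} {child : Fin k → BagTree W}
    {f : W → Option V} (hf : f ∈ bagMappings V B)
    {g : Fin k → W → Option V} (hg : ∀ j i, (g j i).isSome ↔ (child j).Occurs i) (i : W) :
    (joinMappings f g i).isSome ↔ (BagTree.node B k child).Occurs i := by
  rw [BagTree.occurs_node, joinMappings, Option.isSome_or, Bool.or_eq_true, mem_bagMappings.1 hf i,
    List.isSome_findSome?, List.any_eq_true]
  simp [hg]

theorem dynTable_isSubtreeSolution {t : BagTree W} (hc : t.Connected) {f g : W → Option V}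
    (hf : f ∈ bagMappings V t.rootBag) (h : dynTable S R P t f = some g) :
    IsSubtreeSolution S R P t g ∧ ∀ i ∈ t.rootBag, g i = f i := by
  induction t generalizing f g with
  | node B k child ih =>
    obtain ⟨hok, g', hbest, rfl⟩ := dynTable_node_eq_some.1 h
    change f ∈ bagMappings V B at hf
    have hch : ∀ j, IsSubtreeSolution S R P (child j) (g' j) ∧
        ∀ i ∈ B, i ∈ (child j).rootBag → g' j i = f i := by
      intro j
      obtain ⟨g₀, h1, h2, h3⟩ := mem_entries (hbest j)
      obtain ⟨h4, h5⟩ := ih j (hc.2.2 j) h1 h3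
      exact ⟨h4, fun i hi hi' => (h5 i hi').trans (h2 i hi hi')⟩
    have hdom := fun j => (hch j).1.1
    refine ⟨⟨joinMappings_isSome hf hdom, fun A hA => ?_⟩, fun i hi =>
      joinMappings_of_mem hf g' hi⟩
    rcases BagTree.mem_bags_node.1 hA with rfl | ⟨j, hA⟩
    · exact hok.congr fun i hi => (joinMappings_of_mem hf g' hi).symm
    · exact ((hch j).1.2 A hA).congr fun i hi =>
        (joinMappings_of_occurs hc hf hdom (fun j => (hch j).2) ⟨A, hA, hi⟩).symm

theorem restrict_mem_bagMappings {B : Finset W} {h : W → Option V} (hB : BagOK S R P B h) :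
    restrict (B : Set W) h ∈ bagMappings V B := by
  refine mem_bagMappings.2 fun i => ?_
  by_cases hi : i ∈ B
  · obtain ⟨u, hu, -⟩ := hB.1 i hi
    simp [restrict_of_mem (Finset.mem_coe.2 hi), hu, hi]
  · simp [restrict_of_notMem (fun h' => hi (Finset.mem_coe.1 h')), hi]

/-- An exchange argument: `h`, restricted to each child's root bag, is compatible with `h` on `B`,
so by induction each selected child entry costs at most `h` below that child. The join and `h` agree
on `B`, so their overlap costs coincide and cancel. -/
theorem exists_dynTable_le {t : BagTree W} (hc : t.Connected) (hE : t.CoversEdges R.edges)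
    {h : W → Option V} (hh : ∀ B ∈ t.bags, BagOK S R P B h) :
    ∃ g, dynTable S R P t (restrict (t.rootBag : Set W) h) = some g ∧
      partialCost S R P g ≤ partialCost S R P (restrict {i | t.Occurs i} h) := by
  induction t with
  | node B k child ih =>
    change ∃ g, dynTable S R P (.node B k child) (restrict (B : Set W) h) = some g ∧ _
    have hBok := hh B (BagTree.rootBag_mem_bags _)
    have hf := restrict_mem_bagMappings hBok
    have hch : ∀ j, ∃ g, bestEntry S R P B (restrict (B : Set W) h) (child j) = some g ∧
        partialCost S R P g ≤ partialCost S R P (restrict {i | (child j).Occurs i} h) := by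
      intro j
      have hj : ∀ A ∈ (child j).bags, BagOK S R P A h := fun A hA =>
        hh A (BagTree.mem_bags_node.2 (.inr ⟨j, hA⟩))
      obtain ⟨g', h1, h2⟩ := ih j (hc.2.2 j) (hE.child hc j) hj
      obtain ⟨g, h3, h4⟩ := exists_bestEntry (B := B) (f := restrict (B : Set W) h)
        (restrict_mem_bagMappings (hj _ (BagTree.rootBag_mem_bags _)))
        (fun i hi hi' => by
          rw [restrict_of_mem (Finset.mem_coe.2 hi), restrict_of_mem (Finset.mem_coe.2 hi')]) h1
      exact ⟨g, h3, h4.trans h2⟩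
    choose g hbest hle using hch
    have hg : ∀ j, IsSubtreeSolution S R P (child j) (g j) ∧
        ∀ i ∈ B, i ∈ (child j).rootBag → g j i = restrict (B : Set W) h i := by
      intro j
      obtain ⟨g₀, h1, h2, h3⟩ := mem_entries (hbest j)
      obtain ⟨h4, h5⟩ := dynTable_isSubtreeSolution (hc.2.2 j) h1 h3
      exact ⟨h4, fun i hi hi' => (h5 i hi').trans (h2 i hi hi')⟩
    have hdom := fun j => (hg j).1.1
    set r := joinMappings (restrict (B : Set W) h) g with hr
    refine ⟨r, dynTable_node_eq_some.2
      ⟨hBok.congr fun i hi => (restrict_of_mem (Finset.mem_coe.2 hi)).symm, g, hbest, rfl⟩, ?_⟩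
    have hrB : ∀ i ∈ (B : Set W), r i = h i := fun i hi =>
      (joinMappings_of_mem hf g (Finset.mem_coe.1 hi)).trans (restrict_of_mem hi)
    have hocc : {i | (BagTree.node B k child).Occurs i} =
        (B : Set W) ∪ ⋃ j, {i | (child j).Occurs i} := by
      ext i; simp [BagTree.occurs_node]
    have hadd := partialCost_restrict_union S R P (B := (B : Set W))
      (X := fun j => {i | (child j).Occurs i}) (fun j j' hj i => hc.2.1 j j' hj i) ?_
    · rw [hocc]
      have h1 := hadd r
      have h2 := hadd h
      have hr1 : r = restrict ((B : Set W) ∪ ⋃ j, {i | (child j).Occurs i}) r := by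
        refine eq_restrict (fun i hi => ?_) fun _ _ => rfl
        have := (joinMappings_isSome (child := child) hf hdom i).not.2
          (fun ho => hi (hocc ▸ ho))
        simpa using this
      have hr2 : ∀ j, restrict {i | (child j).Occurs i} r = g j := fun j =>
        (eq_restrict (fun i hi => by simpa using (hdom j i).not.2 hi) fun i hi =>
          (joinMappings_of_occurs hc hf hdom (fun j => (hg j).2) hi).symm).symm
      have hr3 : ∀ j, restrict ((B : Set W) ∩ {i | (child j).Occurs i}) r =
          restrict ((B : Set W) ∩ {i | (child j).Occurs i}) h := fun j =>
        restrict_congr fun i hi => hrB i hi.1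
      rw [← hr1, restrict_congr hrB] at h1
      simp only [hr2, hr3] at h1
      -- The term cancelled is the total cost of the overlaps of `B` with the subtrees, common to
      -- `h1` and `h2`.
      refine le_of_add_le_add_right (h1.trans_le (le_trans ?_ h2.ge))
      exact add_le_add_right (Finset.sum_le_sum fun j _ => hle j) _
    · intro e he h1 h2
      rw [← hocc] at h1 h2
      obtain ⟨A, hA, h3, h4⟩ := hE e he h1 h2
      rcases BagTree.mem_bags_node.1 hA with rfl | ⟨j, hA⟩
      · exact .inl ⟨h3, h4⟩
      · exact .inr ⟨j, ⟨A, hA, h3⟩, ⟨A, hA, h4⟩⟩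

theorem dynNodeMapping_spec {t : BagTree W} (ht : t.IsTreeDecomposition R.edges)
    (hex : ∃ h : W → Option V, ∀ B, BagOK S R P B h) :
    ∃ f, dynNodeMapping S R P t = some f ∧ (∀ i, ∃ u, f i = some u ∧ NodeOK S R i u) ∧
      (∀ e : R.edges, ∃ u w, f e.1.1 = some u ∧ f e.1.2 = some w ∧ (P e u w).isSome) ∧
      ∀ h : W → Option V, (∀ B, BagOK S R P B h) → partialCost S R P f ≤ partialCost S R P h := by
  obtain ⟨hocc, hedge, hc⟩ := ht
  have hcand : ∀ h : W → Option V, (∀ B, BagOK S R P B h) →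
      ∃ g ∈ (bagMappings V t.rootBag).filterMap (fun f => dynTable S R P t f),
        partialCost S R P g ≤ partialCost S R P h := by
    intro h hh
    obtain ⟨g, h1, h2⟩ := exists_dynTable_le hc (fun e he _ _ => hedge e he) fun B _ => hh B
    refine ⟨g, List.mem_filterMap.2 ⟨_, restrict_mem_bagMappings (hh _), h1⟩, h2.trans_eq ?_⟩
    -- Every request node occurs in the tree, so the restriction is `h` itself.
    rw [← eq_restrict (X := {i | t.Occurs i}) (fun i hi => (hi (hocc i)).elim) fun _ _ => rfl]
  rcases hm : dynNodeMapping S R P t with _ | f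
  · obtain ⟨h, hh⟩ := hex
    obtain ⟨g, hg, -⟩ := hcand h hh
    rw [dynNodeMapping, List.argmin_eq_none] at hm
    simp [hm] at hg
  · obtain ⟨f₀, h1, h2⟩ := List.mem_filterMap.1 (List.argmin_mem hm)
    obtain ⟨⟨-, hok⟩, -⟩ := dynTable_isSubtreeSolution hc h1 h2
    refine ⟨f, rfl, fun i => ?_, fun e => ?_, fun h hh => ?_⟩
    · obtain ⟨B, hB, hi⟩ := hocc i
      exact (hok B hB).1 i hi
    · obtain ⟨B, hB, h3, h4⟩ := hedge e.1 e.2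
      exact (hok B hB).2 e h3 h4
    · obtain ⟨g, hg, hle⟩ := hcand h hh
      exact (List.le_of_mem_argmin (f := partialCost S R P) hg hm).trans hle

end DynTable

theorem partialCost_some {W V : Type*} [FinEnum W] (S : Substrate V) (R : Request W V)
    (P : R.edges → V → V → Option (List V)) (n : W → V) :
    partialCost S R P (fun i => some (n i)) = ∑ i, R.nodeDemand i * S.nodeCost (n i) +
      ∑ e : R.edges, R.edgeDemand e.1 *
        (P e (n e.1.1) (n e.1.2)).elim 0 (pathWeight S.edgeCost) := rfl

/-! ### The cost of a mapping as a sum over the request -/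

section MappingCost

variable {W V : Type*} [FinEnum W] [FinEnum V] {S : Substrate V} {R : Request W V}

/-- Allocations count an edge once per path, path weights once per traversal; a simple path repeats
no edge. -/
theorem sum_edgeCost_eq_pathWeight (c : V × V → ℝ≥0) {E : Finset (V × V)} {p : List V}
    (hE : ∀ x ∈ pathEdges p, x ∈ E) (hp : p.Nodup) :
    ∑ x ∈ E with x ∈ pathEdges p, c x = pathWeight c p := by
  rw [pathWeight, ← List.sum_toFinset c (pathEdges_nodup hp)]
  refine Finset.sum_congr ?_ fun _ _ => rfl
  ext x
  simpa using hE x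

/-- The cost of a valid mapping, as a sum over the request nodes and edges. -/
theorem Mapping.Valid.cost_eq {m : Mapping R} (hm : m.Valid S) :
    m.cost S = ∑ i, R.nodeDemand i * S.nodeCost (m.node i) +
      ∑ e : R.edges, R.edgeDemand e.1 * pathWeight S.edgeCost (m.edge e) := by
  unfold Mapping.cost Mapping.nodeAlloc Mapping.edgeAlloc
  congr 1
  · simp only [Finset.mul_sum, Finset.sum_filter]
    rw [Finset.sum_comm]
    refine Finset.sum_congr rfl fun i _ => ?_
    simp [mul_comm]
  · simp only [Finset.mul_sum, Finset.sum_filter]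
    rw [Finset.sum_comm]
    refine Finset.sum_congr rfl fun e _ => ?_
    obtain ⟨-, -, hc, hn⟩ := hm.2 e
    rw [← sum_edgeCost_eq_pathWeight S.edgeCost (E := S.edges)
      (fun x hx => (Finset.mem_filter.1 (pathEdges_mem_of_isChain hc hx)).1) hn,
      Finset.mul_sum, Finset.sum_filter]
    refine Finset.sum_congr rfl fun x _ => ?_
    split_ifs <;> simp [mul_comm]

end MappingCost

end VNEP

/-! ### The approximation guarantee -/

theorem lemma2 {W V : Type*} [FinEnum W] [FinEnum V]
    (S : VNEP.Substrate V) (R : VNEP.Request W V)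
    (t : VNEP.BagTree W) (ht : t.IsTreeDecomposition R.edges)
    (ε : NNReal) (hε : 0 < ε)
    (hex : ∃ m : VNEP.Mapping R, m.StrictlyValid S) :
    ∃ m : VNEP.Mapping R,
      VNEP.dynVMPGoel S R ε t = Part.some (some m) ∧
      m.ApproxValid S ε ∧
      ∀ m' : VNEP.Mapping R, m'.StrictlyValid S → m.cost S ≤ m'.cost S := by
  open VNEP in
  choose P hP hspec using fun e : R.edges =>
    aprspGoel_spec (usableEdges S R e.1) S.edgeCost S.latency R.latencyBound hε
  have hpath : ∀ m' : Mapping R, m'.StrictlyValid S → ∀ e : R.edges,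
      ∃ p, P e (m'.node e.1.1) (m'.node e.1.2) = some p ∧
        pathWeight S.edgeCost p ≤ pathWeight S.edgeCost (m'.edge e) := by
    intro m' hm' e
    have h := (hspec e _ _).2 _ (hm'.1.2 e) (hm'.2 e)
    rcases hp : P e (m'.node e.1.1) (m'.node e.1.2) with _ | p
    · rw [hp, entryCost_none] at h
      -- A missing path would have cost `⊤`, but the path of `m'` bounds it by a finite value.
      exact absurd h (by simp)
    · rw [hp, entryCost_some, ENNReal.coe_le_coe] at h
      exact ⟨p, rfl, h⟩
  have hbag : ∀ m' : Mapping R, m'.StrictlyValid S →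
      ∀ B, BagOK S R P B fun i => some (m'.node i) := by
    intro m' hm' B
    refine ⟨fun i _ => ⟨_, rfl, hm'.1.1 i⟩, fun e _ _ => ⟨_, _, rfl, rfl, ?_⟩⟩
    obtain ⟨p, hp, -⟩ := hpath m' hm' e
    simp [hp]
  obtain ⟨f, hf, hnode, hedge, hmin⟩ :=
    dynNodeMapping_spec ht (hex.imp' _ fun m' hm' => hbag m' hm')
  choose n hn hnok using hnode
  obtain rfl : f = fun i => some (n i) := funext hn
  have hsome : ∀ e : R.edges, (P e (n e.1.1) (n e.1.2)).isSome := by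
    intro e
    obtain ⟨u, w, hu, hw, h⟩ := hedge e
    cases hu
    cases hw
    exact h
  have hedge' : ∀ e : R.edges, P e (n e.1.1) (n e.1.2) =
      some ((P e (n e.1.1) (n e.1.2)).get (hsome e)) := fun e => by simp
  let m : Mapping R := ⟨n, fun e => (P e (n e.1.1) (n e.1.2)).get (hsome e)⟩
  have hvalid : m.Valid S := ⟨hnok, fun e => ((hspec e _ _).1 _ (hedge' e)).1⟩
  refine ⟨m, ?_, ⟨hvalid, fun e => ((hspec e _ _).1 _ (hedge' e)).2⟩, fun m' hm' => ?_⟩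
  · rw [dynVMPGoel, runAll_eq_some hP, Part.map_some, dynVMPWith, hf, Option.bind_some]
    exact congrArg Part.some ((dif_pos fun _ => rfl).trans (dif_pos hsome))
  · rw [hvalid.cost_eq, hm'.1.cost_eq]
    calc _ = partialCost S R P (fun i => some (n i)) := by
          rw [partialCost_some]
          congr 1
          refine Finset.sum_congr rfl fun e _ => ?_
          -- All precomputed paths used here exist, so the default cost `0` in `partialCost` is
          -- never taken.
          rw [hedge' e]
          rfl
      _ ≤ partialCost S R P (fun i => some (m'.node i)) := hmin _ (hbag m' hm')
      _ ≤ _ := by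
          rw [partialCost_some]
          gcongr with e
          obtain ⟨p, hp, hle⟩ := hpath m' hm' e
          rw [hp]
          exact hle
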